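/- Let $f:(0,\infty)\to\mathbb C$ be a measurable function such that $$\int_0^\infty \Bigl(1+\frac1x\Bigr)|f(x)|\,dx<\infty ,$$ and suppose that its cosine transform $\widetilde f(y)=\int_0^\infty 2\cos(2\pi xy)f(x)\,dx$ satisfies $$\int^\infty \log(y)\,|\widetilde f(y)|\,dy<\infty$$ (that is, $\int_A^\infty \log(y)\,|\widetilde f(y)|\,dy<\infty$ for some $A>1$). Then $\widetilde f\in L^1(0,\infty;dy)$, and $f$ coincides almost everywhere on $(0,\infty)$ with a function continuous on $[0,\infty)$. Replace $f$ by this (unique) continuous representative. Then: 1. the series in $$F(x)=\sum_{n\ge1}\frac{f(n/x)}{x}-\int_0^\infty f(u)\,du$$ converges absolutely for almost every $x>0$, and $F\in L^1(0,\infty;dx)$; 2. the series $\sum_{m\ge1}\frac{f(\xi/m)}{m}$ converges uniformly for $\xi$ in any interval $[0,X]$; 3. for every $\xi\ge0$, $$\int_0^\infty 2\cos(2\pi\xi x)\,F(x)\,dx=\sum_{m\ge1}\frac{f(\xi/m)}{m}-\int_0^\infty\frac{f(u)}{u}\,du .$$ -/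

import Mathlib

open Set Filter MeasureTheory

noncomputable section

/-- The cosine transform `y ↦ ∫_0^∞ 2 cos(2πxy) f(x) dx` of a function on the half-line. Only the
values of `f` on `(0, ∞)` matter. -/
def cosTransform (f : ℝ → ℂ) (y : ℝ) : ℂ :=
  ∫ x in Ioi (0 : ℝ), ((2 * Real.cos (2 * Real.pi * x * y) : ℝ) : ℂ) * f x

/-- The `n`-th term (`n = 0, 1, 2, …`) `f((n+1)/x) / x` of the sum `∑_{n ≥ 1} f(n/x)/x`. -/
def sumTerm (f : ℝ → ℂ) (n : ℕ) (x : ℝ) : ℂ :=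
  f (((n : ℝ) + 1) / x) / (x : ℂ)

/-- `F(x) = ∑_{n ≥ 1} f(n/x)/x - ∫_0^∞ f(u) du`. -/
def modifiedSum (f : ℝ → ℂ) (x : ℝ) : ℂ :=
  (∑' n : ℕ, sumTerm f n x) - ∫ u in Ioi (0 : ℝ), f u

/-- The `m`-th term (`m = 0, 1, 2, …`) `f(ξ/(m+1)) / (m+1)` of the co-sum `∑_{m ≥ 1} f(ξ/m)/m`. -/
def coSumTerm (f : ℝ → ℂ) (m : ℕ) (ξ : ℝ) : ℂ :=
  f (ξ / ((m : ℝ) + 1)) / ((m : ℂ) + 1)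

/-- The co-sum `∑_{m ≥ 1} f(ξ/m)/m`. -/
def coSum (f : ℝ → ℂ) (ξ : ℝ) : ℂ :=
  ∑' m : ℕ, coSumTerm f m ξ

end

open scoped FourierTransform SchwartzMap Topology ContDiff

/-! ### The cosine transform of integrable functions -/

/-! Write `φ` for the cosine transform of `f`. The engine is classical Poisson summation for an even
Schwartz function `Θ` dilated by `u`: `∑ Θ(n/u)/u - ∫_0^∞ Θ = ∑ 𝓕Θ(nu) - Θ(0)/(2u)`. Multiplying by
`g(u)` and integrating gives `∫ F Θ = ∑ ∫ g(u) 𝓕Θ(nu) du - (Θ(0)/2) ∫ g(u)/u du`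
(`hasSum_integral_modifiedSum_mul`). The exchanges are legitimate because `∑ v/(v+n)² ≤ 1` for every
`v > 0`, together with integrability of `g` and of `g(u)/u`.

Everything follows by varying `Θ`. If `Θ` vanishes on `[0, 1]`, the multiplication formula turns the
right side into `∑ ∫ φ(nx) Θ(x) dx`, so `F(x) = ∑ φ(nx)` almost everywhere on `(1, ∞)`. The
logarithm enters here: `∑ ∫_1^∞ |φ(nx)| dx = ∫ |φ(y)| ∑_{n<y} 1/n dy`. Near `0`, `F` is integrable
by absolute convergence alone. With `𝓕Θ` in place of `Θ`, the pairing says that the cosine transform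
of `F` and the co-sum minus `∫ g(u)/u du` agree as distributions; both are continuous, so they agree
pointwise.

Continuity of the co-sum needs uniform convergence. Inversion makes `g` the cosine transform of `φ`,
and integrability of `g(u)/u` forces `g(0) = 0`, that is, `∫ φ = 0`. Hence `g(ξ/m)/m = (1/m) ∫
(2cos(2πyξ/m) - 2) φ(y) dy`, and the logarithmic weight pays for a Weierstrass majorant. -/

lemma norm_two_cos_le (t : ℝ) : ‖((2 * Real.cos t : ℝ) : ℂ)‖ ≤ 2 := by
  rw [Complex.norm_real, Real.norm_eq_abs, abs_mul, abs_two]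
  linarith [Real.abs_cos_le_one t]

lemma cosTransform_congr_ae {f g : ℝ → ℂ} (h : g =ᵐ[volume.restrict (Ioi (0 : ℝ))] f) :
    cosTransform g = cosTransform f := by
  funext y
  refine integral_congr_ae ?_
  filter_upwards [h] with x hx
  rw [hx]

lemma continuous_cosTransform {f : ℝ → ℂ} (hf : IntegrableOn f (Ioi (0 : ℝ))) :
    Continuous (cosTransform f) := by
  refine continuous_of_dominated (bound := fun x => 2 * ‖f x‖) (fun y => ?_) (fun y => ?_) ?_ ?_
  · exact (by fun_prop : Continuous fun x : ℝ =>
      ((2 * Real.cos (2 * Real.pi * x * y) : ℝ) : ℂ)).aestronglyMeasurable.mul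
      hf.aestronglyMeasurable
  · refine ae_of_all _ fun x => ?_
    rw [norm_mul]
    gcongr
    exact norm_two_cos_le _
  · exact hf.norm.const_mul 2
  · refine ae_of_all _ fun x => ?_
    fun_prop

lemma cosTransform_zero (f : ℝ → ℂ) : cosTransform f 0 = 2 * ∫ x in Ioi (0 : ℝ), f x := by
  simp [cosTransform, integral_const_mul]

/-- Multiplication formula for the cosine transform, with a dilation. -/
lemma integral_mul_cosTransform_dilation {a b : ℝ → ℂ} (ha : IntegrableOn a (Ioi (0 : ℝ)))
    (hb : IntegrableOn b (Ioi (0 : ℝ))) (c : ℝ) :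
    ∫ u in Ioi (0 : ℝ), a u * cosTransform b (c * u) =
      ∫ x in Ioi (0 : ℝ), cosTransform a (c * x) * b x := by
  simp only [cosTransform, ← integral_const_mul, ← integral_mul_const]
  rw [integral_integral_swap]
  · refine integral_congr_ae (ae_of_all _ fun x => integral_congr_ae (ae_of_all _ fun u => ?_))
    have : 2 * Real.pi * x * (c * u) = 2 * Real.pi * u * (c * x) := by ring
    simp only [this]
    ring
  · have h := (Integrable.mul_prod ha hb).bdd_mul (c := 2)
      (f := fun p : ℝ × ℝ => ((2 * Real.cos (2 * Real.pi * p.2 * (c * p.1)) : ℝ) : ℂ))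
      (by fun_prop : Continuous _).aestronglyMeasurable
      (ae_of_all _ fun p => norm_two_cos_le _)
    refine h.congr (ae_of_all _ fun p => ?_)
    simp only [Function.uncurry]
    ring

/-! ### Even Schwartz functions -/

lemma integral_eq_two_mul_integral_Ioi_of_even {G : ℝ → ℂ} (hG : Integrable G)
    (he : ∀ x, G (-x) = G x) : ∫ x, G x = 2 * ∫ x in Ioi (0 : ℝ), G x := by
  have h := integral_comp_neg_Ioi (0 : ℝ) G
  simp only [he, neg_zero] at h
  rw [← intervalIntegral.integral_Iic_add_Ioi (b := (0 : ℝ)) hG.integrableOn hG.integrableOn, ← h,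
    two_mul]

/-- Averaging the integrals against `exp(-iθ)` and `exp(iθ)`, which agree by evenness, leaves the
cosine, and the two half-lines contribute equally. It lets half-line statements be tested with the
full-line Fourier theory of Schwartz functions. -/
lemma fourier_eq_cosTransform {Θ : 𝓢(ℝ, ℂ)} (he : ∀ x, Θ (-x) = Θ x) (y : ℝ) :
    𝓕 Θ y = cosTransform Θ y := by
  have hint : Integrable (fun x : ℝ => ((2 * Real.cos (2 * Real.pi * x * y) : ℝ) : ℂ) * Θ x) :=
    Θ.integrable.bdd_mul (c := 2) (by fun_prop : Continuous _).aestronglyMeasurable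
      (ae_of_all _ fun _ => norm_two_cos_le _)
  have hexp : ∀ s : ℝ, Integrable
      (fun x : ℝ => Complex.exp ((s * (2 * Real.pi * x * y) : ℝ) * Complex.I) * Θ x) := fun s =>
    Θ.integrable.bdd_mul (c := 1) (by fun_prop : Continuous _).aestronglyMeasurable
      (ae_of_all _ fun _ => (Complex.norm_exp_ofReal_mul_I _).le)
  have h1 : 𝓕 Θ y = ∫ x : ℝ, Complex.exp (((-1) * (2 * Real.pi * x * y) : ℝ) * Complex.I) * Θ x := by
    rw [SchwartzMap.fourier_coe, Real.fourier_real_eq_integral_exp_smul]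
    refine integral_congr_ae (ae_of_all _ fun x => ?_)
    simp only [smul_eq_mul]
    congr 4
    ring
  have h2 : 𝓕 Θ y = ∫ x : ℝ, Complex.exp ((1 * (2 * Real.pi * x * y) : ℝ) * Complex.I) * Θ x := by
    rw [h1, ← integral_neg_eq_self]
    refine integral_congr_ae (ae_of_all _ fun x => ?_)
    simp only [he]
    congr 4
    ring
  have h3 : 𝓕 Θ y + 𝓕 Θ y =
      ∫ x : ℝ, ((2 * Real.cos (2 * Real.pi * x * y) : ℝ) : ℂ) * Θ x := by
    nth_rewrite 1 [h1]
    rw [h2, ← integral_add (hexp _) (hexp _)]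
    refine integral_congr_ae (ae_of_all _ fun x => ?_)
    simp only [← add_mul]
    congr 1
    push_cast
    rw [Complex.two_cos]
    ring_nf
  rw [integral_eq_two_mul_integral_Ioi_of_even hint, ← two_mul] at h3
  · exact mul_left_cancel₀ two_ne_zero h3
  · intro x
    rw [he]
    congr 3
    rw [← Real.cos_neg]
    ring_nf

lemma integral_Ioi_eq_fourier_zero_div_two {Θ : 𝓢(ℝ, ℂ)} (he : ∀ x, Θ (-x) = Θ x) :
    ∫ x in Ioi (0 : ℝ), Θ x = 𝓕 Θ 0 / 2 := by
  rw [fourier_eq_cosTransform he, cosTransform_zero]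
  ring

lemma fourier_even {Θ : 𝓢(ℝ, ℂ)} (he : ∀ x, Θ (-x) = Θ x) (y : ℝ) : 𝓕 Θ (-y) = 𝓕 Θ y := by
  rw [fourier_eq_cosTransform he, fourier_eq_cosTransform he]
  simp [cosTransform]

lemma fourier_fourier_of_even {Θ : 𝓢(ℝ, ℂ)} (he : ∀ x, Θ (-x) = Θ x) : 𝓕 (𝓕 Θ) = Θ := by
  ext x
  have h : 𝓕⁻ (𝓕 Θ) = Θ := FourierTransform.fourierInv_fourier_eq Θ
  conv_rhs => rw [← h]
  rw [SchwartzMap.fourierInv_coe, Real.fourierInv_eq_fourier_neg, ← SchwartzMap.fourier_coe,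
    fourier_even (fourier_even he)]

/-- A Schwartz function is bounded by a multiple of `(1 + |x|)⁻²`. -/
lemma SchwartzMap.exists_norm_le_div_sq (Θ : 𝓢(ℝ, ℂ)) :
    ∃ C : ℝ, 0 ≤ C ∧ ∀ x : ℝ, ‖Θ x‖ ≤ C / (1 + |x|) ^ 2 := by
  obtain ⟨A, hA, h0⟩ := Θ.decay 0 0
  obtain ⟨B, hB, h2⟩ := Θ.decay 2 0
  refine ⟨2 * (A + B), by positivity, fun x => ?_⟩
  have h0 := h0 x
  have h2 := h2 x
  rw [norm_iteratedFDeriv_zero, pow_zero, one_mul] at h0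
  rw [norm_iteratedFDeriv_zero, Real.norm_eq_abs] at h2
  rw [le_div_iff₀ (by positivity)]
  -- The factor 2 comes from `(1 + |x|)² ≤ 2(1 + x²)`.
  nlinarith [mul_nonneg (norm_nonneg (Θ x)) (sq_nonneg (1 - |x|))]

/-- A smooth function compactly supported in `(0, ∞)` extends to an even Schwartz function. -/
lemma exists_even_schwartz {ψ : ℝ → ℝ} (h1 : ContDiff ℝ ∞ ψ) (h2 : HasCompactSupport ψ)
    (h3 : tsupport ψ ⊆ Ioi 0) :
    ∃ Θ : 𝓢(ℝ, ℂ), (∀ x, Θ (-x) = Θ x) ∧ (∀ x, 0 < x → Θ x = ψ x) ∧ Θ 0 = 0 := by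
  have hz : ∀ x ≤ 0, ψ x = 0 := fun x hx =>
    image_eq_zero_of_notMem_tsupport fun h => (not_lt.2 hx) (h3 h)
  have hc : HasCompactSupport (fun x : ℝ => ((ψ x : ℂ) + (ψ (-x) : ℂ))) := by
    have h4 : HasCompactSupport (fun x : ℝ => (ψ x : ℂ)) :=
      h2.comp_left (g := fun r : ℝ => (r : ℂ)) Complex.ofReal_zero
    have h5 : HasCompactSupport (fun x : ℝ => (ψ (-x) : ℂ)) :=
      h4.comp_homeomorph (Homeomorph.neg ℝ)
    exact h4.add h5
  have hd : ContDiff ℝ ∞ (fun x : ℝ => ((ψ x : ℂ) + (ψ (-x) : ℂ))) :=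
    (Complex.ofRealCLM.contDiff.comp h1).add
      (Complex.ofRealCLM.contDiff.comp (h1.comp contDiff_neg))
  refine ⟨hc.toSchwartzMap hd, fun x => ?_, fun x hx => ?_, ?_⟩
  · change ((ψ (-x) : ℂ) + (ψ (- -x) : ℂ)) = ((ψ x : ℂ) + (ψ (-x) : ℂ))
    rw [neg_neg, add_comm]
  · change ((ψ x : ℂ) + (ψ (-x) : ℂ)) = _
    simp [hz (-x) (by linarith)]
  · change ((ψ 0 : ℂ) + (ψ (-0) : ℂ)) = _
    simp [hz 0 le_rfl]

/-! ### The sum `∑ v / (v + n)²` and Poisson summation -/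

/-- Telescoping: each term is at most `v/(v+n) - v/(v+n+1) = v/((v+n)(v+n+1))`. The bound is
independent of `v`, so it controls all dilations at once. -/
lemma sum_div_add_sq_le {v : ℝ} (hv : 0 < v) (N : ℕ) :
    ∑ n ∈ Finset.range N, v / (v + (n + 1)) ^ 2 ≤ 1 := by
  have h : ∀ n : ℕ, v / (v + (n + 1)) ^ 2 ≤ v / (v + n) - v / (v + ((n + 1 : ℕ) : ℝ)) := by
    intro n
    push_cast
    rw [div_sub_div _ _ (by positivity) (by positivity),
      div_le_div_iff₀ (by positivity) (by positivity)]
    have : 0 ≤ v * (v + (n + 1)) := by positivity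
    nlinarith
  calc _ ≤ ∑ n ∈ Finset.range N, (v / (v + n) - v / (v + ((n + 1 : ℕ) : ℝ))) :=
        Finset.sum_le_sum fun n _ => h n
    _ = v / (v + (0 : ℕ)) - v / (v + N) := Finset.sum_range_sub' (fun n : ℕ => v / (v + n)) N
    _ ≤ 1 := by
        have : 0 ≤ v / (v + N) := by positivity
        simp only [Nat.cast_zero, add_zero, div_self hv.ne']
        linarith

lemma sum_norm_dilation_le {w : ℝ → ℂ} {C : ℝ} (hC : 0 ≤ C)
    (hw : ∀ x, ‖w x‖ ≤ C / (1 + |x|) ^ 2) {u : ℝ} (hu : 0 < u) (N : ℕ) :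
    ∑ n ∈ Finset.range N, ‖w ((n + 1) / u) / u‖ ≤ C := by
  calc _ ≤ ∑ n ∈ Finset.range N, C * (u / (u + (n + 1)) ^ 2) := by
        refine Finset.sum_le_sum fun n _ => ?_
        rw [norm_div, Complex.norm_real, Real.norm_eq_abs, abs_of_pos hu, div_le_iff₀ hu]
        refine (hw _).trans_eq ?_
        rw [abs_of_pos (by positivity)]
        field_simp
    _ ≤ C := by
        rw [← Finset.mul_sum]
        exact mul_le_of_le_one_right hC (sum_div_add_sq_le hu N)

lemma summable_dilation {w : ℝ → ℂ} {C : ℝ} (hC : 0 ≤ C)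
    (hw : ∀ x, ‖w x‖ ≤ C / (1 + |x|) ^ 2) {u : ℝ} (hu : 0 < u) :
    Summable fun n : ℕ => w ((n + 1) / u) / u :=
  .of_norm (summable_of_sum_range_le (fun _ => norm_nonneg _) (sum_norm_dilation_le hC hw hu))

lemma sum_norm_mul_dilation_le {w : ℝ → ℂ} {C : ℝ} (hC : 0 ≤ C)
    (hw : ∀ x, ‖w x‖ ≤ C / (1 + |x|) ^ 2) {u : ℝ} (hu : 0 < u) (N : ℕ) :
    ∑ n ∈ Finset.range N, ‖u * w ((n + 1) * u)‖ ≤ C := by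
  have h := sum_norm_dilation_le hC hw (inv_pos.2 hu) N
  refine le_of_eq_of_le (Finset.sum_congr rfl fun n _ => ?_) h
  rw [Complex.ofReal_inv, div_inv_eq_mul, div_inv_eq_mul, mul_comm]

lemma tsum_int_of_even {G : ℝ → ℂ} (he : ∀ x, G (-x) = G x)
    (hs : Summable fun n : ℕ => G (n + 1)) :
    ∑' n : ℤ, G n = G 0 + 2 * ∑' n : ℕ, G (n + 1) := by
  have hs0 : Summable fun n : ℕ => G ((n : ℤ) : ℝ) := by
    rw [← summable_nat_add_iff 1]
    simpa using hs
  have hneg : ∀ n : ℕ, G ((-((n : ℤ) + 1) : ℤ) : ℝ) = G (n + 1) := fun n => by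
    push_cast
    rw [← he]
    ring_nf
  rw [tsum_of_nat_of_neg_add_one (f := fun n : ℤ => G n) hs0 (by simpa only [hneg] using hs),
    hs0.tsum_eq_zero_add]
  simp only [hneg]
  push_cast
  ring

lemma cosTransform_dilation (f : ℝ → ℂ) {u : ℝ} (hu : 0 < u) (y : ℝ) :
    cosTransform (fun x => f (u⁻¹ * x)) y = u * cosTransform f (u * y) := by
  have h := integral_comp_mul_left_Ioi
    (fun x : ℝ => ((2 * Real.cos (2 * Real.pi * x * (u * y)) : ℝ) : ℂ) * f x) 0 (inv_pos.2 hu)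
  rw [mul_zero, inv_inv, Complex.real_smul] at h
  rw [cosTransform, cosTransform, ← h]
  refine integral_congr_ae (ae_of_all _ fun x => ?_)
  have : 2 * Real.pi * (u⁻¹ * x) * (u * y) = 2 * Real.pi * x * y := by field_simp
  simp only [this]

/-- Poisson summation for a dilated even Schwartz function. -/
lemma poisson_even_schwartz {Θ : 𝓢(ℝ, ℂ)} (he : ∀ x, Θ (-x) = Θ x) {u : ℝ} (hu : 0 < u) :
    (∑' n : ℕ, Θ ((n + 1) / u) / u) - 𝓕 Θ 0 / 2 =
      (∑' n : ℕ, 𝓕 Θ ((n + 1) * u)) - Θ 0 / (2 * u) := by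
  have huC : (u : ℂ) ≠ 0 := by exact_mod_cast hu.ne'
  let Λ : 𝓢(ℝ, ℂ) := SchwartzMap.compCLMOfContinuousLinearEquiv ℂ
    (ContinuousLinearEquiv.smulLeft (Units.mk0 u⁻¹ (inv_ne_zero hu.ne'))) Θ
  have hΛ : ∀ x, Λ x = Θ (u⁻¹ * x) := fun x => rfl
  have hΛe : ∀ x, Λ (-x) = Λ x := fun x => by rw [hΛ, hΛ, mul_neg, he]
  have hFΛ : ∀ y, 𝓕 Λ y = u * 𝓕 Θ (u * y) := fun y => by
    rw [fourier_eq_cosTransform hΛe, fourier_eq_cosTransform he, ← cosTransform_dilation Θ hu]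
    rfl
  have hsum : ∀ Ξ : 𝓢(ℝ, ℂ), Summable fun n : ℕ => Ξ (n + 1) := fun Ξ => by
    obtain ⟨C, hC, h⟩ := Ξ.exists_norm_le_div_sq
    simpa using summable_dilation hC h one_pos
  have hP := SchwartzMap.tsum_eq_tsum_fourier Λ 0
  simp only [zero_add, QuotientAddGroup.mk_zero, fourier_eval_zero, mul_one] at hP
  rw [tsum_int_of_even hΛe (hsum Λ), tsum_int_of_even (fourier_even hΛe) (hsum (𝓕 Λ))] at hP
  simp only [hFΛ, hΛ, mul_zero, tsum_mul_left] at hP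
  have e1 : ∀ n : ℕ, Θ (((n : ℝ) + 1) / u) = Θ (u⁻¹ * (n + 1)) := fun n => by
    rw [div_eq_inv_mul]
  have e2 : ∀ n : ℕ, 𝓕 Θ (((n : ℝ) + 1) * u) = 𝓕 Θ (u * (n + 1)) := fun n => by
    rw [mul_comm]
  simp only [e1, e2, tsum_div_const]
  generalize ∑' n : ℕ, Θ (u⁻¹ * (n + 1)) = A at hP ⊢
  generalize ∑' n : ℕ, 𝓕 Θ (u * (n + 1)) = B at hP ⊢
  field_simp
  linear_combination hP

/-! ### Integration of series -/

section Series

variable {α : Type*} [MeasurableSpace α] {μ : Measure α}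

lemma tsum_lintegral_enorm_ne_top {F : ℕ → α → ℂ} (hF : ∀ n, Integrable (F n) μ)
    (hs : Summable fun n => ∫ x, ‖F n x‖ ∂μ) : ∑' n, ∫⁻ x, ‖F n x‖ₑ ∂μ ≠ ⊤ := by
  simp only [← ofReal_integral_norm_eq_lintegral_enorm (hF _)]
  rw [← ENNReal.ofReal_tsum_of_nonneg (fun n => integral_nonneg fun _ => norm_nonneg _) hs]
  exact ENNReal.ofReal_ne_top

lemma lintegral_tsum_enorm_ne_top {F : ℕ → α → ℂ} (hF : ∀ n, Integrable (F n) μ)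
    (hs : Summable fun n => ∫ x, ‖F n x‖ ∂μ) : ∫⁻ x, ∑' n, ‖F n x‖ₑ ∂μ ≠ ⊤ := by
  rw [lintegral_tsum fun n => (hF n).1.enorm]
  exact tsum_lintegral_enorm_ne_top hF hs

lemma ae_summable_of_summable_integral_norm {F : ℕ → α → ℂ} (hF : ∀ n, Integrable (F n) μ)
    (hs : Summable fun n => ∫ x, ‖F n x‖ ∂μ) : ∀ᵐ x ∂μ, Summable fun n => F n x := by
  have h := ae_lt_top' (AEMeasurable.tsum fun n => (hF n).1.enorm)
    (lintegral_tsum_enorm_ne_top hF hs)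
  filter_upwards [h] with x hx
  exact .of_norm (tsum_enorm_ne_top_iff_summable_norm.1 hx.ne)

lemma integrable_tsum_of_summable_integral_norm {F : ℕ → α → ℂ} (hF : ∀ n, Integrable (F n) μ)
    (hs : Summable fun n => ∫ x, ‖F n x‖ ∂μ) : Integrable (fun x => ∑' n, F n x) μ := by
  refine ⟨?_, ?_⟩
  · refine aestronglyMeasurable_of_tendsto_ae atTop
      (f := fun N x => ∑ n ∈ Finset.range N, F n x) (fun N => ?_) ?_
    · exact Finset.aestronglyMeasurable_fun_sum _ fun n _ => (hF n).1
    · filter_upwards [ae_summable_of_summable_integral_norm hF hs] with x hx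
      exact hx.hasSum.tendsto_sum_nat
  · exact (lintegral_mono fun x => enorm_tsum_le_tsum_enorm).trans_lt
      (lintegral_tsum_enorm_ne_top hF hs).lt_top

/-- Multiplying an integrable function by kernels whose absolute values have bounded sum. -/
lemma integrable_mul_of_sum_norm_le {a : α → ℂ} (ha : Integrable a μ) {k : ℕ → α → ℂ}
    (hk : ∀ n, AEStronglyMeasurable (k n) μ) {C : ℝ}
    (hC : ∀ᵐ x ∂μ, ∀ N, ∑ n ∈ Finset.range N, ‖k n x‖ ≤ C) :
    (∀ n, Integrable (fun x => a x * k n x) μ) ∧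
      Summable fun n => ∫ x, ‖a x * k n x‖ ∂μ := by
  have h1 : ∀ n, Integrable (fun x => a x * k n x) μ := fun n => by
    refine (ha.bdd_mul (c := C) (hk n) ?_).congr (ae_of_all _ fun x => mul_comm _ _)
    filter_upwards [hC] with x hx
    exact (Finset.single_le_sum (f := fun n => ‖k n x‖) (fun _ _ => norm_nonneg _)
      (Finset.self_mem_range_succ n)).trans (hx (n + 1))
  refine ⟨h1, summable_of_sum_range_le (c := ∫ x, ‖a x‖ * C ∂μ)
    (fun n => integral_nonneg fun _ => norm_nonneg _) fun N => ?_⟩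
  rw [← integral_finsetSum _ fun n _ => (h1 n).norm]
  refine integral_mono_ae (integrable_finsetSum _ fun n _ => (h1 n).norm)
    (ha.norm.mul_const C) ?_
  filter_upwards [hC] with x hx
  simp only [norm_mul, ← Finset.mul_sum]
  exact mul_le_mul_of_nonneg_left (hx N) (norm_nonneg _)

end Series

/-! ### The inversion `x ↦ c / x` on the half-line -/

lemma image_const_div_Ioi {c : ℝ} (hc : 0 < c) : (fun x : ℝ => c / x) '' Ioi 0 = Ioi 0 := by
  ext u
  constructor
  · rintro ⟨x, hx, rfl⟩
    exact div_pos hc hx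
  · intro hu
    exact ⟨c / u, div_pos hc hu, by field_simp⟩

lemma hasDerivWithinAt_const_div {c x : ℝ} (hx : x ∈ Ioi (0 : ℝ)) :
    HasDerivWithinAt (fun x : ℝ => c / x) (-c / x ^ 2) (Ioi 0) x := by
  have h := ((hasDerivAt_inv (ne_of_gt hx)).const_mul c).hasDerivWithinAt (s := Ioi 0)
  simpa [div_eq_mul_inv] using h

lemma injOn_const_div {c : ℝ} (hc : 0 < c) : InjOn (fun x : ℝ => c / x) (Ioi 0) := by
  intro x hx y hy h
  have hx : 0 < x := hx
  have hy : 0 < y := hy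
  simp only at h
  rw [div_eq_div_iff hx.ne' hy.ne'] at h
  exact (mul_left_cancel₀ hc.ne' h).symm

lemma integral_const_div_Ioi {E : Type*} [NormedAddCommGroup E] [NormedSpace ℝ E] {c : ℝ}
    (hc : 0 < c) (G : ℝ → E) :
    ∫ x in Ioi (0 : ℝ), (c / x ^ 2) • G (c / x) = ∫ u in Ioi (0 : ℝ), G u := by
  have h := integral_image_eq_integral_abs_deriv_smul measurableSet_Ioi
    (fun x hx => hasDerivWithinAt_const_div (c := c) hx) (injOn_const_div hc) G
  rw [image_const_div_Ioi hc] at h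
  rw [h]
  refine integral_congr_ae (ae_of_all _ fun x => ?_)
  simp only [abs_div, abs_neg, abs_of_pos hc, abs_pow, sq_abs]

lemma integrableOn_const_div_Ioi {E : Type*} [NormedAddCommGroup E] [NormedSpace ℝ E] {c : ℝ}
    (hc : 0 < c) {G : ℝ → E} (hG : IntegrableOn G (Ioi (0 : ℝ))) :
    IntegrableOn (fun x => (c / x ^ 2) • G (c / x)) (Ioi (0 : ℝ)) := by
  rw [← image_const_div_Ioi hc, integrableOn_image_iff_integrableOn_abs_deriv_smul measurableSet_Ioi
    (fun x hx => hasDerivWithinAt_const_div (c := c) hx) (injOn_const_div hc)] at hG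
  refine hG.congr (ae_of_all _ fun x => ?_)
  simp only [abs_div, abs_neg, abs_of_pos hc, abs_pow, sq_abs]

/-! ### Pairing the series `∑ g(n/x)/x` with a weight -/

section Pairing

variable {g : ℝ → ℂ} {w : ℝ → ℂ} {C : ℝ}

lemma sumTerm_mul_eq (g w : ℝ → ℂ) (n : ℕ) {x : ℝ} (hx : x ∈ Ioi (0 : ℝ)) :
    (((n : ℝ) + 1) / x ^ 2) • (g (((n : ℝ) + 1) / x) *
      (w ((n + 1) / (((n : ℝ) + 1) / x)) / ((((n : ℝ) + 1) / x : ℝ) : ℂ))) =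
      sumTerm g n x * w x := by
  have hx : 0 < x := hx
  have hxC : (x : ℂ) ≠ 0 := by exact_mod_cast hx.ne'
  have hn : (0 : ℝ) < (n : ℝ) + 1 := by positivity
  have hnC : (n : ℂ) + 1 ≠ 0 := by exact_mod_cast hn.ne'
  have e : ((n : ℝ) + 1) / (((n : ℝ) + 1) / x) = x := by field_simp
  rw [e, sumTerm, Complex.real_smul]
  push_cast
  field_simp

lemma integral_sumTerm_mul (g w : ℝ → ℂ) (n : ℕ) :
    ∫ x in Ioi (0 : ℝ), sumTerm g n x * w x =
      ∫ u in Ioi (0 : ℝ), g u * (w ((n + 1) / u) / u) := by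
  rw [← integral_const_div_Ioi (c := (n : ℝ) + 1) (by positivity)
    fun u => g u * (w ((n + 1) / u) / u)]
  exact setIntegral_congr_fun measurableSet_Ioi fun x hx => (sumTerm_mul_eq g w n hx).symm

lemma integral_norm_sumTerm_mul (g w : ℝ → ℂ) (n : ℕ) :
    ∫ x in Ioi (0 : ℝ), ‖sumTerm g n x * w x‖ =
      ∫ u in Ioi (0 : ℝ), ‖g u * (w ((n + 1) / u) / u)‖ := by
  rw [← integral_const_div_Ioi (c := (n : ℝ) + 1) (by positivity)
    fun u => ‖g u * (w ((n + 1) / u) / u)‖]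
  refine setIntegral_congr_fun measurableSet_Ioi fun x hx => ?_
  simp only [← sumTerm_mul_eq g w n hx]
  rw [norm_smul, Real.norm_of_nonneg (by positivity), smul_eq_mul]

lemma integrable_mul_dilation (hg : IntegrableOn g (Ioi (0 : ℝ))) (hwc : Continuous w)
    (hC : 0 ≤ C) (hw : ∀ x, ‖w x‖ ≤ C / (1 + |x|) ^ 2) :
    (∀ n : ℕ, IntegrableOn (fun u => g u * (w ((n + 1) / u) / u)) (Ioi (0 : ℝ))) ∧
      Summable fun n : ℕ => ∫ u in Ioi (0 : ℝ), ‖g u * (w ((n + 1) / u) / u)‖ := by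
  refine integrable_mul_of_sum_norm_le (k := fun n u => w ((n + 1) / u) / u) hg (C := C)
    (fun n => ?_) ?_
  · refine ContinuousOn.aestronglyMeasurable (fun u hu => ?_) measurableSet_Ioi
    have hu : 0 < u := hu
    refine ContinuousAt.continuousWithinAt (ContinuousAt.div ?_ (by fun_prop) ?_)
    · exact ContinuousAt.comp' hwc.continuousAt (continuousAt_const.div continuousAt_id hu.ne')
    · exact_mod_cast hu.ne'
  · filter_upwards [ae_restrict_mem measurableSet_Ioi] with u hu
    exact sum_norm_dilation_le hC hw hu

/-- The product is split as `(g(u)/u) · (u w((n+1)u))`, since it is `∑ u |w(nu)|` that is bounded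
uniformly in `u`; this is why integrability of `g(u)/u` is required. -/
lemma integrable_mul_dilation_mul (hg : IntegrableOn (fun u => g u / (u : ℂ)) (Ioi (0 : ℝ)))
    (hwc : Continuous w) (hC : 0 ≤ C) (hw : ∀ x, ‖w x‖ ≤ C / (1 + |x|) ^ 2) :
    (∀ n : ℕ, IntegrableOn (fun u => g u * w ((n + 1) * u)) (Ioi (0 : ℝ))) ∧
      Summable fun n : ℕ => ∫ u in Ioi (0 : ℝ), ‖g u * w ((n + 1) * u)‖ := by
  have h := integrable_mul_of_sum_norm_le (k := fun n u => u * w ((n + 1) * u)) hg (C := C)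
    (fun n => (by fun_prop : Continuous _).aestronglyMeasurable) (by
      filter_upwards [ae_restrict_mem measurableSet_Ioi] with u hu
      exact sum_norm_mul_dilation_le hC hw hu)
  have e : ∀ n : ℕ, ∀ u ∈ Ioi (0 : ℝ),
      g u / (u : ℂ) * (u * w ((n + 1) * u)) = g u * w ((n + 1) * u) := fun n u hu => by
    have : (u : ℂ) ≠ 0 := by exact_mod_cast (ne_of_gt hu)
    field_simp
  refine ⟨fun n => IntegrableOn.congr_fun (h.1 n) (e n) measurableSet_Ioi, h.2.congr fun n => ?_⟩
  exact setIntegral_congr_fun measurableSet_Ioi fun u hu => by simp only [e n u hu]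

lemma integrable_sumTerm_mul (hg : IntegrableOn g (Ioi (0 : ℝ))) (hwc : Continuous w)
    (hC : 0 ≤ C) (hw : ∀ x, ‖w x‖ ≤ C / (1 + |x|) ^ 2) :
    (∀ n : ℕ, IntegrableOn (fun x => sumTerm g n x * w x) (Ioi (0 : ℝ))) ∧
      Summable fun n : ℕ => ∫ x in Ioi (0 : ℝ), ‖sumTerm g n x * w x‖ := by
  obtain ⟨h1, h2⟩ := integrable_mul_dilation hg hwc hC hw
  refine ⟨fun n => ?_, by simpa only [integral_norm_sumTerm_mul] using h2⟩
  exact (integrableOn_const_div_Ioi (c := (n : ℝ) + 1) (by positivity) (h1 n)).congr_fun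
    (fun x hx => sumTerm_mul_eq g w n hx) measurableSet_Ioi

lemma norm_inv_one_add_abs_sq_le (x : ℝ) :
    ‖(((1 + |x|) ^ 2)⁻¹ : ℝ)‖ ≤ 1 / (1 + |x|) ^ 2 := by
  rw [Real.norm_of_nonneg (by positivity), one_div]

lemma continuous_inv_one_add_abs_sq :
    Continuous fun x : ℝ => (((((1 + |x|) ^ 2)⁻¹ : ℝ)) : ℂ) :=
  Complex.continuous_ofReal.comp
    (Continuous.inv₀ (by fun_prop) fun x => by positivity)

/-- The series `∑ g(n/x)/x` converges absolutely almost everywhere. -/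
lemma ae_summable_sumTerm (hg : IntegrableOn g (Ioi (0 : ℝ))) :
    ∀ᵐ x ∂(volume.restrict (Ioi (0 : ℝ))), Summable fun n : ℕ => sumTerm g n x := by
  obtain ⟨h1, h2⟩ := integrable_sumTerm_mul hg continuous_inv_one_add_abs_sq zero_le_one
    fun x => (Complex.norm_real _).trans_le (norm_inv_one_add_abs_sq_le x)
  filter_upwards [ae_summable_of_summable_integral_norm h1 h2] with x hx
  refine (summable_mul_right_iff ?_).1 hx
  exact_mod_cast (by positivity : (0 : ℝ) < ((1 + |x|) ^ 2)⁻¹).ne'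

lemma integrableOn_tsum_sumTerm_mul (hg : IntegrableOn g (Ioi (0 : ℝ))) (hwc : Continuous w)
    (hC : 0 ≤ C) (hw : ∀ x, ‖w x‖ ≤ C / (1 + |x|) ^ 2) :
    IntegrableOn (fun x => (∑' n, sumTerm g n x) * w x) (Ioi (0 : ℝ)) := by
  obtain ⟨h1, h2⟩ := integrable_sumTerm_mul hg hwc hC hw
  have h := integrable_tsum_of_summable_integral_norm h1 h2
  simp only [tsum_mul_right] at h
  exact h

/-- `F` is integrable near the origin. -/
lemma integrableOn_modifiedSum_Ioc (hg : IntegrableOn g (Ioi (0 : ℝ))) (X : ℝ) :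
    IntegrableOn (modifiedSum g) (Ioc 0 X) := by
  refine Integrable.sub ?_ (integrableOn_const (by simp))
  have h := (integrableOn_tsum_sumTerm_mul hg continuous_inv_one_add_abs_sq zero_le_one
    fun x => (Complex.norm_real _).trans_le (norm_inv_one_add_abs_sq_le x)).mono_set
      (fun x (hx : x ∈ Ioc 0 X) => hx.1)
  -- The decaying weight is cancelled by its inverse, which is bounded on `(0, X]`.
  have h' := h.bdd_mul (c := (1 + |X|) ^ 2) (f := fun x : ℝ => (((1 + |x|) ^ 2 : ℝ) : ℂ))
    (by fun_prop : Continuous _).aestronglyMeasurable (by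
      filter_upwards [ae_restrict_mem measurableSet_Ioc] with x hx
      rw [Complex.norm_real, Real.norm_of_nonneg (by positivity)]
      gcongr
      · exact hx.1.le
      · exact hx.2)
  refine h'.congr (ae_of_all _ fun x => ?_)
  have : (((1 + |x|) ^ 2 : ℝ) : ℂ) ≠ 0 := by
    exact_mod_cast (by positivity : (0 : ℝ) < (1 + |x|) ^ 2).ne'
  simp only [Complex.ofReal_inv]
  field_simp

/-- The pairing of `F` with an even Schwartz function. -/
lemma hasSum_integral_modifiedSum_mul (hg : IntegrableOn g (Ioi (0 : ℝ)))
    (hgd : IntegrableOn (fun u => g u / (u : ℂ)) (Ioi (0 : ℝ))) {Θ : 𝓢(ℝ, ℂ)}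
    (he : ∀ x, Θ (-x) = Θ x) :
    HasSum (fun n : ℕ => ∫ u in Ioi (0 : ℝ), g u * 𝓕 Θ ((n + 1) * u))
      ((∫ x in Ioi (0 : ℝ), modifiedSum g x * Θ x) +
        Θ 0 / 2 * ∫ u in Ioi (0 : ℝ), g u / (u : ℂ)) := by
  obtain ⟨C, hC, hw⟩ := Θ.exists_norm_le_div_sq
  obtain ⟨D, hD, hv⟩ := (𝓕 Θ).exists_norm_le_div_sq
  obtain ⟨a1, a2⟩ := integrable_mul_dilation hg Θ.continuous hC hw
  obtain ⟨b1, b2⟩ := integrable_mul_dilation_mul hgd (𝓕 Θ).continuous hD hv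
  obtain ⟨c1, c2⟩ := integrable_sumTerm_mul hg Θ.continuous hC hw
  have hF : ∫ x in Ioi (0 : ℝ), modifiedSum g x * Θ x =
      (∫ u in Ioi (0 : ℝ), g u * ∑' n : ℕ, Θ ((n + 1) / u) / u) -
        (∫ u in Ioi (0 : ℝ), g u) * (𝓕 Θ 0 / 2) := by
    simp only [modifiedSum, sub_mul]
    rw [integral_sub (integrableOn_tsum_sumTerm_mul hg Θ.continuous hC hw)
      (Θ.integrable.integrableOn.const_mul _), integral_const_mul, integral_Ioi_eq_fourier_zero_div_two he]
    congr 1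
    simp only [← tsum_mul_right, ← tsum_mul_left]
    rw [← integral_tsum_of_summable_integral_norm c1 c2,
      ← integral_tsum_of_summable_integral_norm a1 a2]
    simp only [integral_sumTerm_mul]
  have hsum := hasSum_integral_of_summable_integral_norm b1 b2
  simp only [tsum_mul_left] at hsum
  -- Poisson summation for each fixed `u`; the term `Θ(0)/(2u)` produces the integral of `g(u)/u`.
  have hp : ∀ u ∈ Ioi (0 : ℝ), g u * ∑' n : ℕ, 𝓕 Θ ((n + 1) * u) =
      g u * (∑' n : ℕ, Θ ((n + 1) / u) / u) - g u * (𝓕 Θ 0 / 2) +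
        Θ 0 / 2 * (g u / (u : ℂ)) := fun u hu => by
    have : (u : ℂ) ≠ 0 := by exact_mod_cast (ne_of_gt hu)
    rw [← mul_sub, poisson_even_schwartz he hu]
    generalize ∑' n : ℕ, 𝓕 Θ ((n + 1) * u) = B
    field_simp
    ring
  rw [setIntegral_congr_fun measurableSet_Ioi hp, integral_add, integral_sub, integral_const_mul,
    integral_mul_const, ← hF] at hsum
  · exact hsum
  · simpa only [tsum_mul_left] using integrable_tsum_of_summable_integral_norm a1 a2
  · exact hg.mul_const _
  · refine Integrable.sub ?_ (hg.mul_const _)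
    simpa only [tsum_mul_left] using integrable_tsum_of_summable_integral_norm a1 a2
  · exact hgd.const_mul _

end Pairing

/-! ### Testing against even Schwartz functions, and Fourier inversion -/

lemma norm_cosTransform_le {f : ℝ → ℂ} (hf : IntegrableOn f (Ioi (0 : ℝ))) (y : ℝ) :
    ‖cosTransform f y‖ ≤ ∫ x in Ioi (0 : ℝ), 2 * ‖f x‖ := by
  refine norm_integral_le_of_norm_le (hf.norm.const_mul 2) (ae_of_all _ fun x => ?_)
  rw [norm_mul]
  gcongr
  exact norm_two_cos_le _

lemma SchwartzMap.exists_norm_le (Θ : 𝓢(ℝ, ℂ)) : ∃ C : ℝ, ∀ x : ℝ, ‖Θ x‖ ≤ C := by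
  obtain ⟨C, -, h⟩ := Θ.decay 0 0
  exact ⟨C, fun x => by simpa using h x⟩

lemma integrableOn_mul_schwartz {a : ℝ → ℂ} {s : Set ℝ} (ha : IntegrableOn a s) (Θ : 𝓢(ℝ, ℂ)) :
    IntegrableOn (fun x => a x * Θ x) s := by
  obtain ⟨C, hC⟩ := Θ.exists_norm_le
  exact (ha.bdd_mul Θ.continuous.aestronglyMeasurable (ae_of_all _ hC)).congr
    (ae_of_all _ fun x => mul_comm _ _)

lemma integrable_cosTransform_mul_schwartz {a : ℝ → ℂ} (ha : IntegrableOn a (Ioi (0 : ℝ)))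
    (Θ : 𝓢(ℝ, ℂ)) : Integrable (fun x => cosTransform a x * Θ x) :=
  Θ.integrable.bdd_mul (continuous_cosTransform ha).aestronglyMeasurable
    (ae_of_all _ (norm_cosTransform_le ha))

/-- A bump supported in `U` agrees on `(0, ∞)` with an even Schwartz function, so even tests detect
everything on the half-line. The vanishing of `Θ` at `0` and off `U` is recorded to localise the
test to `(1, ∞)` later. -/
lemma ae_eq_zero_of_forall_even_schwartz {d : ℝ → ℂ} {U : Set ℝ} (hU : IsOpen U)
    (hU0 : U ⊆ Ioi 0) (hd : LocallyIntegrableOn d U)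
    (h : ∀ Θ : 𝓢(ℝ, ℂ), (∀ x, Θ (-x) = Θ x) → Θ 0 = 0 → (∀ x, 0 < x → x ∉ U → Θ x = 0) →
      ∫ x in Ioi (0 : ℝ), d x * Θ x = 0) :
    ∀ᵐ x, x ∈ U → d x = 0 := by
  refine hU.ae_eq_zero_of_integral_contDiff_smul_eq_zero hd fun ψ h1 h2 h3 => ?_
  obtain ⟨Θ, he, hΘ, h0⟩ := exists_even_schwartz h1 h2 (h3.trans hU0)
  have hz : ∀ x ∉ U, ψ x = 0 := fun x hx =>
    image_eq_zero_of_notMem_tsupport fun hx' => hx (h3 hx')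
  rw [← h Θ he h0 fun x hx hxU => by rw [hΘ x hx, hz x hxU, Complex.ofReal_zero],
    ← setIntegral_eq_integral_of_forall_compl_eq_zero (s := Ioi (0 : ℝ)) (fun x hx => by
      rw [hz x fun hxU => hx (hU0 hxU), zero_smul])]
  refine setIntegral_congr_fun measurableSet_Ioi fun x hx => ?_
  simp only [hΘ x hx, Complex.real_smul, mul_comm]

/-- Almost everywhere inversion of the cosine transform. -/
lemma cosTransform_cosTransform_ae {f : ℝ → ℂ} (hf : IntegrableOn f (Ioi (0 : ℝ)))
    (hφ : IntegrableOn (cosTransform f) (Ioi (0 : ℝ))) :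
    cosTransform (cosTransform f) =ᵐ[volume.restrict (Ioi (0 : ℝ))] f := by
  have hfl : LocallyIntegrableOn (fun x => cosTransform (cosTransform f) x - f x)
      (Ioi (0 : ℝ)) := by
    refine LocallyIntegrableOn.sub ?_ hf.locallyIntegrableOn
    exact (continuous_cosTransform hφ).locallyIntegrable.locallyIntegrableOn _
  have key := ae_eq_zero_of_forall_even_schwartz isOpen_Ioi Subset.rfl hfl
    fun Θ he _ _ => by
      simp only [sub_mul]
      rw [integral_sub (integrable_cosTransform_mul_schwartz hφ Θ).integrableOn
        (integrableOn_mul_schwartz hf Θ), sub_eq_zero]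
      -- Both pairings become `∫ cosTransform f · 𝓕 Θ`: one by moving the outer transform onto `Θ`,
      -- the other by writing `Θ = 𝓕 (𝓕 Θ)`.
      have h1 := integral_mul_cosTransform_dilation hφ (Θ.integrable.integrableOn (s := Ioi 0)) 1
      have h2 := integral_mul_cosTransform_dilation hf
        ((𝓕 Θ).integrable.integrableOn (s := Ioi 0)) 1
      simp only [one_mul, ← fourier_eq_cosTransform he,
        ← fourier_eq_cosTransform (fourier_even he), fourier_fourier_of_even he] at h1 h2
      rw [← h1, ← h2]
  rw [Filter.EventuallyEq, ae_restrict_iff' measurableSet_Ioi]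
  filter_upwards [key] with x hx hx0
  exact sub_eq_zero.1 (hx hx0)

/-! ### Consequences of the logarithmic integrability -/

/-- The first term is at most `1`. For `m ≥ 2`, `1 - 1/t ≤ log t` gives `a/(m(m+a)) ≤ log(1 +
a/(m-1)) - log(1 + a/m)`, which telescopes. -/
lemma sum_div_mul_add_le {a : ℝ} (ha : 0 ≤ a) (N : ℕ) :
    ∑ n ∈ Finset.range N, a / (((n : ℝ) + 1) * (n + 1 + a)) ≤ 1 + Real.log (1 + a) := by
  have hstep : ∀ n : ℕ, a / (((n : ℝ) + 1 + 1) * (n + 1 + 1 + a)) ≤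
      Real.log (1 + a / ((n : ℝ) + 1)) - Real.log (1 + a / (((n + 1 : ℕ) : ℝ) + 1)) := by
    intro n
    have hn : (0 : ℝ) < (n : ℝ) + 1 := by positivity
    push_cast
    rw [← Real.log_div (by positivity) (by positivity)]
    refine le_trans ?_ (Real.one_sub_inv_le_log_of_pos (by positivity))
    have e : 1 - ((1 + a / ((n : ℝ) + 1)) / (1 + a / ((n : ℝ) + 1 + 1)))⁻¹ =
        a / (((n : ℝ) + 1 + 1) * (n + 1 + a)) := by
      field_simp
      ring
    rw [e]
    gcongr
    linarith
  rcases N with - | N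
  · simpa using add_nonneg zero_le_one (Real.log_nonneg (by linarith : 1 ≤ 1 + a))
  rw [Finset.sum_range_succ', add_comm]
  refine add_le_add ?_ ?_
  · simp only [Nat.cast_zero, zero_add, one_mul]
    exact div_le_one_of_le₀ (by linarith) (by linarith)
  · push_cast
    refine (Finset.sum_le_sum fun n _ => hstep n).trans ?_
    rw [Finset.sum_range_sub' fun n : ℕ => Real.log (1 + a / ((n : ℝ) + 1))]
    have : 0 ≤ Real.log (1 + a / ((N : ℝ) + 1)) :=
      Real.log_nonneg (le_add_of_nonneg_right (by positivity))
    simp only [Nat.cast_zero, zero_add, div_one]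
    linarith

/-- The integrability of `(1 + log (1 + y)) φ(y)` on the half-line. -/
def LogIntegrable (φ : ℝ → ℂ) : Prop :=
  IntegrableOn (fun y : ℝ => ((1 + Real.log (1 + y) : ℝ) : ℂ) * φ y) (Ioi (0 : ℝ))

lemma one_le_one_add_log {y : ℝ} (hy : 0 < y) : 1 ≤ 1 + Real.log (1 + y) :=
  le_add_of_nonneg_right (Real.log_nonneg (by linarith))

/-- Continuity covers bounded `y`; for `y ≥ 2` the weight `1 + log(1+y)` is at most `4 log y`. -/
lemma logIntegrable_of_integrableAtFilter {φ : ℝ → ℂ} (hc : Continuous φ)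
    (h : IntegrableAtFilter (fun y : ℝ => Real.log y * ‖φ y‖) atTop volume) :
    LogIntegrable φ := by
  obtain ⟨s, hs, hint⟩ := h
  obtain ⟨A, hA⟩ := mem_atTop_sets.1 hs
  set B := max A 2
  have hB : IntegrableOn (fun y : ℝ => Real.log y * ‖φ y‖) (Ioi B) :=
    hint.mono_set fun y hy => hA y ((le_max_left A 2).trans (le_of_lt hy))
  have hcont : ContinuousOn (fun y : ℝ => ((1 + Real.log (1 + y) : ℝ) : ℂ) * φ y) (Ici 0) := by
    intro y hy
    have hy : 0 ≤ y := hy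
    have : 1 + y ≠ 0 := by positivity
    refine ContinuousAt.continuousWithinAt ?_
    fun_prop (disch := assumption)
  have hB0 : 0 ≤ B := le_max_of_le_right zero_le_two
  rw [LogIntegrable, ← Ioc_union_Ioi_eq_Ioi hB0]
  refine IntegrableOn.union ?_ ?_
  · exact ((hcont.mono Icc_subset_Ici_self).integrableOn_compact isCompact_Icc).mono_set
      Ioc_subset_Icc_self
  · refine Integrable.mono' (hB.const_mul 4)
      ((hcont.mono fun y hy => hB0.trans (le_of_lt hy)).aestronglyMeasurable measurableSet_Ioi) ?_
    filter_upwards [ae_restrict_mem measurableSet_Ioi] with y hy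
    have hy2 : 2 ≤ y := (le_max_right A 2).trans (le_of_lt hy)
    have h1 : Real.log (1 + y) ≤ 2 * Real.log y := by
      have h3 : Real.log (1 + y) ≤ Real.log (y ^ 2) :=
        Real.log_le_log (by linarith) (by nlinarith)
      rwa [Real.log_pow, Nat.cast_ofNat] at h3
    have h2 : 1 ≤ 2 * Real.log y := by
      have := Real.log_le_log two_pos hy2
      linarith [Real.log_two_gt_d9]
    have h3 := one_le_one_add_log (by linarith : 0 < y)
    rw [norm_mul, Complex.norm_real, Real.norm_of_nonneg (by linarith), ← mul_assoc]
    gcongr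
    linarith

section LogWeight

variable {φ : ℝ → ℂ}

/-- Moving the weight from `φ` to the kernels reduces logarithmically growing sums to bounded ones.
-/
lemma LogIntegrable.integrable_mul_kernel (hφ : LogIntegrable φ) {k : ℕ → ℝ → ℝ}
    (hk : ∀ n, Measurable (k n)) {C : ℝ}
    (hC : ∀ y, 0 < y → ∀ N, ∑ n ∈ Finset.range N, |k n y| ≤ C * (1 + Real.log (1 + y))) :
    (∀ n, IntegrableOn (fun y => φ y * (k n y : ℂ)) (Ioi (0 : ℝ))) ∧
      Summable fun n => ∫ y in Ioi (0 : ℝ), ‖φ y * (k n y : ℂ)‖ := by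
  have h := integrable_mul_of_sum_norm_le hφ
    (k := fun n y => ((k n y / (1 + Real.log (1 + y)) : ℝ) : ℂ)) (C := C)
    (fun n => (by fun_prop : Measurable _).aestronglyMeasurable) (by
      filter_upwards [ae_restrict_mem measurableSet_Ioi] with y hy N
      have hp := one_le_one_add_log hy
      simp only [Complex.norm_real, Real.norm_eq_abs, abs_div, ← Finset.sum_div]
      rw [abs_of_pos (by linarith : 0 < 1 + Real.log (1 + y)), div_le_iff₀ (by linarith)]
      exact hC y hy N)
  have e : ∀ n, ∀ y ∈ Ioi (0 : ℝ), ((1 + Real.log (1 + y) : ℝ) : ℂ) * φ y *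
      ((k n y / (1 + Real.log (1 + y)) : ℝ) : ℂ) = φ y * (k n y : ℂ) := fun n y hy => by
    have hp := one_le_one_add_log hy
    have : ((1 + Real.log (1 + y) : ℝ) : ℂ) ≠ 0 := by
      exact_mod_cast (by linarith : (0 : ℝ) < 1 + Real.log (1 + y)).ne'
    rw [Complex.ofReal_div]
    field_simp
  refine ⟨fun n => IntegrableOn.congr_fun (h.1 n) (e n) measurableSet_Ioi, h.2.congr fun n => ?_⟩
  exact setIntegral_congr_fun measurableSet_Ioi fun u hu => by simp only [e n u hu]

lemma LogIntegrable.integrableOn (hφ : LogIntegrable φ) : IntegrableOn φ (Ioi (0 : ℝ)) := by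
  have h := (hφ.integrable_mul_kernel (k := fun n _ => if n = 0 then 1 else 0) (C := 1)
    (fun n => measurable_const) (fun y hy N => ?_)).1 0
  · simpa using h
  · rw [one_mul]
    refine le_trans ?_ (one_le_one_add_log hy)
    calc ∑ n ∈ Finset.range N, |if n = 0 then (1 : ℝ) else 0|
        = ∑ n ∈ Finset.range N, if n = 0 then (1 : ℝ) else 0 := by
          refine Finset.sum_congr rfl fun n _ => ?_
          split_ifs <;> simp
      _ ≤ 1 := by
          rw [Finset.sum_ite_eq']
          split_ifs <;> simp

/-- The dilation series `∑ φ(n x)` converges in `L¹(1, ∞)`. -/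
lemma LogIntegrable.integrable_dilation (hφ : LogIntegrable φ) :
    (∀ n : ℕ, IntegrableOn (fun x => φ ((n + 1) * x)) (Ioi (1 : ℝ))) ∧
      Summable fun n : ℕ => ∫ x in Ioi (1 : ℝ), ‖φ ((n + 1) * x)‖ := by
  have hn : ∀ n : ℕ, (0 : ℝ) < (n : ℝ) + 1 := fun n => by positivity
  refine ⟨fun n => ?_, ?_⟩
  · rw [integrableOn_Ioi_comp_mul_left_iff φ 1 (hn n), mul_one]
    exact hφ.integrableOn.mono_set (Ioi_subset_Ioi (hn n).le)
  have h := (hφ.integrable_mul_kernel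
    (k := fun n y => (Ioi ((n : ℝ) + 1)).indicator (fun _ => ((n : ℝ) + 1)⁻¹) y) (C := 2)
    (fun n => measurable_const.indicator measurableSet_Ioi) (fun y hy N => ?_)).2
  · refine h.congr fun n => ?_
    rw [integral_comp_mul_left_Ioi (fun x => ‖φ x‖) 1 (hn n), mul_one, smul_eq_mul,
      ← integral_const_mul, ← integral_indicator measurableSet_Ioi,
      ← integral_indicator measurableSet_Ioi]
    congr 1
    funext y
    by_cases hy : (n : ℝ) + 1 < y
    · rw [indicator_of_mem (show y ∈ Ioi (0 : ℝ) from (hn n).trans hy),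
        indicator_of_mem (show y ∈ Ioi ((n : ℝ) + 1) from hy),
        indicator_of_mem (show y ∈ Ioi ((n : ℝ) + 1) from hy), norm_mul, Complex.norm_real,
        Real.norm_of_nonneg (inv_nonneg.2 (hn n).le), mul_comm]
    · simp [indicator_apply, hy]
  -- For `n + 1 < y`, `1/(n+1) ≤ 2y/((n+1)(n+1+y))`, so the harmonic sum inherits the logarithmic
  -- bound.
  · refine le_trans ?_ (mul_le_mul_of_nonneg_left (sum_div_mul_add_le hy.le N) zero_le_two)
    rw [Finset.mul_sum]
    refine Finset.sum_le_sum fun n _ => ?_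
    have := hn n
    by_cases hy' : (n : ℝ) + 1 < y
    · rw [indicator_of_mem (show y ∈ Ioi ((n : ℝ) + 1) from hy'), abs_of_pos (inv_pos.2 this),
        inv_eq_one_div, ← mul_div_assoc, div_le_div_iff₀ this (by positivity)]
      nlinarith
    · rw [indicator_of_notMem (show y ∉ Ioi ((n : ℝ) + 1) from hy'), abs_zero]
      positivity

end LogWeight

/-! ### Integrability of `F` -/

section ModifiedSum

variable {g : ℝ → ℂ}

lemma integrableOn_modifiedSum_mul (hg : IntegrableOn g (Ioi (0 : ℝ))) (Θ : 𝓢(ℝ, ℂ)) :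
    IntegrableOn (fun x => modifiedSum g x * Θ x) (Ioi (0 : ℝ)) := by
  obtain ⟨C, hC, hw⟩ := Θ.exists_norm_le_div_sq
  simp only [modifiedSum, sub_mul]
  exact (integrableOn_tsum_sumTerm_mul hg Θ.continuous hC hw).sub
    (Θ.integrable.integrableOn.const_mul _)

/-- Almost everywhere Poisson summation: `F(x) = ∑ φ(n x)`. -/
lemma modifiedSum_ae_eq_tsum (hg : IntegrableOn g (Ioi (0 : ℝ)))
    (hgd : IntegrableOn (fun u => g u / (u : ℂ)) (Ioi (0 : ℝ)))
    (hφ : LogIntegrable (cosTransform g)) :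
    ∀ᵐ x, x ∈ Ioi (1 : ℝ) → modifiedSum g x = ∑' n : ℕ, cosTransform g ((n + 1) * x) := by
  obtain ⟨d1, d2⟩ := hφ.integrable_dilation
  have hΦ := integrable_tsum_of_summable_integral_norm d1 d2
  have hloc : LocallyIntegrableOn
      (fun x => modifiedSum g x - ∑' n : ℕ, cosTransform g ((n + 1) * x)) (Ioi (1 : ℝ)) := by
    refine LocallyIntegrableOn.sub ?_ (IntegrableOn.locallyIntegrableOn hΦ)
    rw [locallyIntegrableOn_iff isOpen_Ioi.isLocallyClosed]
    intro k hk hkc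
    obtain ⟨X, hX⟩ := hkc.bddAbove
    exact (integrableOn_modifiedSum_Ioc hg X).mono_set fun x hx =>
      ⟨zero_lt_one.trans (hk hx), hX hx⟩
  have key := ae_eq_zero_of_forall_even_schwartz isOpen_Ioi (Ioi_subset_Ioi zero_le_one) hloc
    fun Θ he h0 hout => by
      have hset : ∀ a : ℝ → ℂ, ∫ x in Ioi (0 : ℝ), a x * Θ x = ∫ x in Ioi (1 : ℝ), a x * Θ x :=
        fun a => (setIntegral_eq_of_subset_of_forall_sdiff_eq_zero measurableSet_Ioi
          (Ioi_subset_Ioi zero_le_one) fun x hx => by rw [hout x hx.1 hx.2, mul_zero])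
      obtain ⟨C, hC⟩ := Θ.exists_norm_le
      have e1 : ∀ n : ℕ, IntegrableOn (fun x => cosTransform g ((n + 1) * x) * Θ x)
          (Ioi (1 : ℝ)) := fun n => integrableOn_mul_schwartz (d1 n) Θ
      have e2 : Summable fun n : ℕ =>
          ∫ x in Ioi (1 : ℝ), ‖cosTransform g ((n + 1) * x) * Θ x‖ := by
        refine .of_nonneg_of_le (fun n => integral_nonneg fun _ => norm_nonneg _) (fun n => ?_)
          (d2.mul_right C)
        rw [← integral_mul_const]
        refine integral_mono (e1 n).norm ((d1 n).norm.mul_const C) fun x => ?_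
        simp only [norm_mul]
        exact mul_le_mul_of_nonneg_left (hC x) (norm_nonneg _)
      have hs := hasSum_integral_of_summable_integral_norm e1 e2
      have hF := hasSum_integral_modifiedSum_mul hg hgd he
      -- `Θ 0 = 0` removes the term with the integral of `g(u)/u`.
      rw [h0, zero_div, zero_mul, add_zero] at hF
      have e3 : ∀ n : ℕ, ∫ u in Ioi (0 : ℝ), g u * 𝓕 Θ ((n + 1) * u) =
          ∫ x in Ioi (1 : ℝ), cosTransform g ((n + 1) * x) * Θ x := fun n => by
        simp only [fourier_eq_cosTransform he]
        rw [integral_mul_cosTransform_dilation hg Θ.integrable.integrableOn]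
        exact hset fun x => cosTransform g ((n + 1) * x)
      simp only [e3] at hF
      have heq := hF.unique hs
      rw [hset, ← sub_eq_zero] at heq ⊢
      simp only [tsum_mul_right] at heq
      rw [sub_zero, ← heq, ← integral_sub]
      · simp only [sub_mul]
      · exact (integrableOn_modifiedSum_mul hg Θ).mono_set (Ioi_subset_Ioi zero_le_one)
      · exact integrableOn_mul_schwartz hΦ Θ
  filter_upwards [key] with x hx hx1
  exact sub_eq_zero.1 (hx hx1)

lemma integrableOn_modifiedSum (hg : IntegrableOn g (Ioi (0 : ℝ)))
    (hgd : IntegrableOn (fun u => g u / (u : ℂ)) (Ioi (0 : ℝ)))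
    (hφ : LogIntegrable (cosTransform g)) : IntegrableOn (modifiedSum g) (Ioi (0 : ℝ)) := by
  obtain ⟨d1, d2⟩ := hφ.integrable_dilation
  rw [← Ioc_union_Ioi_eq_Ioi zero_le_one]
  refine (integrableOn_modifiedSum_Ioc hg 1).union ?_
  refine (integrable_tsum_of_summable_integral_norm d1 d2).congr ?_
  rw [Filter.EventuallyEq, ae_restrict_iff' measurableSet_Ioi]
  filter_upwards [modifiedSum_ae_eq_tsum hg hgd hφ] with x hx hx1
  exact (hx hx1).symm

end ModifiedSum

/-! ### The co-sum -/

section CoSum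

variable {g φ : ℝ → ℂ}

/-- For `a ≤ m` the quadratic bound `θ² ≤ a/m` suffices; for `a ≥ m` the trivial bound `4` does. The
quotient `a/(m+a)` captures both regimes. -/
lemma abs_two_cos_sub_two_le {θ a m : ℝ} (ha : 0 ≤ a) (hm : 0 < m) (hθ : |θ| ≤ a / m) :
    |2 * Real.cos θ - 2| ≤ 8 * (a / (m + a)) := by
  have h4 : |2 * Real.cos θ - 2| ≤ 4 := by
    rw [abs_le]
    constructor <;> linarith [Real.neg_one_le_cos θ, Real.cos_le_one θ]
  rcases le_total a m with h | h
  · have h1 : |2 * Real.cos θ - 2| ≤ |θ| * |θ| := by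
      rw [abs_mul_abs_self, abs_le]
      constructor
      · nlinarith [Real.one_sub_sq_div_two_le_cos (x := θ)]
      · nlinarith [Real.cos_le_one θ, mul_self_nonneg θ]
    have h2 : a / m ≤ 1 := div_le_one_of_le₀ h hm.le
    have h3 : |θ| * |θ| ≤ a / m := by nlinarith [abs_nonneg θ]
    refine h1.trans (h3.trans ?_)
    rw [← mul_div_assoc, div_le_div_iff₀ hm (by linarith)]
    nlinarith
  · refine h4.trans ?_
    have : 0 < a := hm.trans_le h
    rw [← mul_div_assoc, le_div_iff₀ (by linarith)]
    linarith

/-- A uniform bound for the terms of the co-sum of the cosine transform of `φ`. -/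
lemma norm_coSumTerm_cosTransform_le (hφ : LogIntegrable φ)
    (h0 : ∫ y in Ioi (0 : ℝ), φ y = 0) (X : ℝ) :
    ∃ M : ℕ → ℝ, Summable M ∧
      ∀ n, ∀ ξ ∈ Icc 0 X, ‖coSumTerm (cosTransform φ) n ξ‖ ≤ M n := by
  set c : ℝ := 2 * Real.pi * |X|
  have hc : 0 ≤ c := by positivity
  have hn : ∀ n : ℕ, (0 : ℝ) < (n : ℝ) + 1 := fun n => by positivity
  obtain ⟨k1, k2⟩ := hφ.integrable_mul_kernel
    (k := fun n y => 8 * (c * y / (((n : ℝ) + 1) * (n + 1 + c * y))))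
    (C := 8 * (1 + Real.log (1 + c))) (fun n => by fun_prop) (fun y hy N => by
      have hcy : 0 ≤ c * y := by positivity
      -- `1 + cy ≤ (1 + c)(1 + y)` separates the dependence on `X` from the weight in `y`.
      have h1 : Real.log (1 + c * y) ≤ Real.log (1 + c) + Real.log (1 + y) := by
        rw [← Real.log_mul (by positivity) (by positivity)]
        exact Real.log_le_log (by positivity) (by nlinarith)
      have h2 : 0 ≤ Real.log (1 + c) := Real.log_nonneg (by linarith)
      have h3 : 0 ≤ Real.log (1 + y) := Real.log_nonneg (by linarith)
      calc ∑ n ∈ Finset.range N, |8 * (c * y / (((n : ℝ) + 1) * (n + 1 + c * y)))|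
          = 8 * ∑ n ∈ Finset.range N, c * y / (((n : ℝ) + 1) * (n + 1 + c * y)) := by
            rw [Finset.mul_sum]
            exact Finset.sum_congr rfl fun n _ => abs_of_nonneg (by positivity)
        _ ≤ 8 * (1 + Real.log (1 + c * y)) := by
            gcongr
            exact sum_div_mul_add_le hcy N
        _ ≤ 8 * (1 + Real.log (1 + c)) * (1 + Real.log (1 + y)) := by
            nlinarith [mul_nonneg h2 h3])
  refine ⟨_, k2, fun n ξ hξ => ?_⟩
  -- Since `∫ φ = 0`, a constant `2` may be subtracted from the kernel, which then is small for
  -- large `n`.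
  have hsub : cosTransform φ (ξ / (n + 1)) = ∫ y in Ioi (0 : ℝ),
      ((2 * Real.cos (2 * Real.pi * y * (ξ / (n + 1))) - 2 : ℝ) : ℂ) * φ y := by
    simp only [Complex.ofReal_sub, sub_mul]
    rw [integral_sub, integral_const_mul, h0, mul_zero, sub_zero, cosTransform]
    · exact hφ.integrableOn.bdd_mul (c := 2) (by fun_prop : Continuous _).aestronglyMeasurable
        (ae_of_all _ fun _ => norm_two_cos_le _)
    · exact hφ.integrableOn.const_mul _
  have hnn : ‖(n : ℂ) + 1‖ = (n : ℝ) + 1 := by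
    rw [← Nat.cast_one, ← Nat.cast_add, Complex.norm_natCast, Nat.cast_add, Nat.cast_one]
  rw [coSumTerm, norm_div, hsub, hnn, div_le_iff₀ (hn n), ← integral_mul_const]
  refine norm_integral_le_of_norm_le ((k1 n).norm.mul_const _) ?_
  filter_upwards [ae_restrict_mem measurableSet_Ioi] with y hy
  have hy : 0 < y := hy
  have hb := abs_two_cos_sub_two_le (θ := 2 * Real.pi * y * (ξ / (n + 1))) (a := c * y)
    (by positivity) (hn n) (by
      have hξ0 := hξ.1
      rw [abs_of_nonneg (by positivity), ← mul_div_assoc]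
      refine div_le_div_of_nonneg_right ?_ (hn n).le
      have : 2 * Real.pi * y * ξ ≤ 2 * Real.pi * y * |X| :=
        mul_le_mul_of_nonneg_left (hξ.2.trans (le_abs_self X)) (by positivity)
      calc _ ≤ _ := this
        _ = c * y := by ring)
  have hr : (0 : ℝ) ≤ 8 * (c * y / (((n : ℝ) + 1) * (n + 1 + c * y))) := by positivity
  simp only [norm_mul, Complex.norm_real, Real.norm_eq_abs]
  rw [← abs_mul, abs_of_nonneg hr]
  calc _ ≤ 8 * (c * y / (n + 1 + c * y)) * ‖φ y‖ := by gcongr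
    _ = _ := by
      have := hn n
      have : (0 : ℝ) < n + 1 + c * y := by positivity
      field_simp

lemma coSumTerm_congr {g h : ℝ → ℂ} (hgh : EqOn g h (Ici 0)) (n : ℕ) :
    EqOn (coSumTerm g n) (coSumTerm h n) (Ici 0) := fun ξ hξ => by
  rw [coSumTerm, coSumTerm, hgh (div_nonneg hξ (by positivity : (0 : ℝ) ≤ (n : ℝ) + 1))]

lemma tendstoUniformlyOn_coSum (hgh : EqOn g (cosTransform φ) (Ici 0)) (hφ : LogIntegrable φ)
    (h0 : ∫ y in Ioi (0 : ℝ), φ y = 0) (X : ℝ) :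
    TendstoUniformlyOn (fun (N : ℕ) (ξ : ℝ) => ∑ m ∈ Finset.range N, coSumTerm g m ξ)
      (coSum g) atTop (Icc 0 X) := by
  obtain ⟨M, hM, hle⟩ := norm_coSumTerm_cosTransform_le hφ h0 X
  refine tendstoUniformlyOn_tsum_nat hM fun n ξ hξ => ?_
  rw [coSumTerm_congr hgh n hξ.1]
  exact hle n ξ hξ

lemma continuousOn_coSum (hg : ContinuousOn g (Ici 0))
    (hu : ∀ X : ℝ, TendstoUniformlyOn
      (fun (N : ℕ) (ξ : ℝ) => ∑ m ∈ Finset.range N, coSumTerm g m ξ)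
      (coSum g) atTop (Icc 0 X)) : ContinuousOn (coSum g) (Ici 0) := by
  intro ξ hξ
  have hX : ContinuousOn (coSum g) (Icc 0 (ξ + 1)) := by
    refine (hu (ξ + 1)).continuousOn (Frequently.of_forall fun N => ?_)
    refine continuousOn_finsetSum _ fun m _ => ContinuousOn.div_const ?_ _
    refine hg.comp (by fun_prop) fun x hx => ?_
    exact div_nonneg hx.1 (by positivity : (0 : ℝ) ≤ (m : ℝ) + 1)
  refine (hX ξ ⟨hξ, by linarith⟩).mono_of_mem_nhdsWithin ?_
  rw [← Ici_inter_Iic]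
  exact inter_mem self_mem_nhdsWithin (nhdsWithin_le_nhds (Iic_mem_nhds (by linarith)))

/-! ### The co-Poisson formula -/

lemma coSumTerm_mul_dilation (g w : ℝ → ℂ) (n : ℕ) (u : ℝ) :
    ((n : ℝ) + 1) • (coSumTerm g n ((n + 1) * u) * w ((n + 1) * u)) =
      g u * w ((n + 1) * u) := by
  have hn : (0 : ℝ) < (n : ℝ) + 1 := by positivity
  have hnC : (n : ℂ) + 1 ≠ 0 := by exact_mod_cast hn.ne'
  rw [coSumTerm, mul_div_cancel_left₀ _ hn.ne', Complex.real_smul]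
  push_cast
  field_simp

lemma integral_coSumTerm_mul (g w : ℝ → ℂ) (n : ℕ) :
    ∫ v in Ioi (0 : ℝ), coSumTerm g n v * w v =
      ∫ u in Ioi (0 : ℝ), g u * w ((n + 1) * u) := by
  have hn : (0 : ℝ) < (n : ℝ) + 1 := by positivity
  have h := integral_comp_mul_left_Ioi (fun v : ℝ => coSumTerm g n v * w v) 0 hn
  rw [mul_zero, eq_inv_smul_iff₀ hn.ne', ← integral_smul] at h
  rw [← h]
  simp only [coSumTerm_mul_dilation]

lemma integral_norm_coSumTerm_mul (g w : ℝ → ℂ) (n : ℕ) :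
    ∫ v in Ioi (0 : ℝ), ‖coSumTerm g n v * w v‖ =
      ∫ u in Ioi (0 : ℝ), ‖g u * w ((n + 1) * u)‖ := by
  have hn : (0 : ℝ) < (n : ℝ) + 1 := by positivity
  have h := integral_comp_mul_left_Ioi (fun v : ℝ => ‖coSumTerm g n v * w v‖) 0 hn
  rw [mul_zero, eq_inv_smul_iff₀ hn.ne', ← integral_smul] at h
  rw [← h]
  simp only [← coSumTerm_mul_dilation g w n, norm_smul, Real.norm_of_nonneg hn.le, smul_eq_mul]

lemma integrable_coSumTerm_mul {w : ℝ → ℂ} {C : ℝ}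
    (hgd : IntegrableOn (fun u => g u / (u : ℂ)) (Ioi (0 : ℝ)))
    (hwc : Continuous w) (hC : 0 ≤ C) (hw : ∀ x, ‖w x‖ ≤ C / (1 + |x|) ^ 2) :
    (∀ n : ℕ, IntegrableOn (fun v => coSumTerm g n v * w v) (Ioi (0 : ℝ))) ∧
      Summable fun n : ℕ => ∫ v in Ioi (0 : ℝ), ‖coSumTerm g n v * w v‖ := by
  obtain ⟨h1, h2⟩ := integrable_mul_dilation_mul hgd hwc hC hw
  refine ⟨fun n => ?_, by simpa only [integral_norm_coSumTerm_mul] using h2⟩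
  have hn : (0 : ℝ) < (n : ℝ) + 1 := by positivity
  have h := integrableOn_Ioi_comp_mul_left_iff (fun v : ℝ => coSumTerm g n v * w v) 0 hn
  rw [mul_zero] at h
  rw [← h]
  have h3 := h1 n
  simp only [← coSumTerm_mul_dilation g w n] at h3
  exact (integrable_smul_iff hn.ne' _).1 h3

/-- The pointwise co-Poisson formula. -/
lemma cosTransform_modifiedSum_eq
    (hg : IntegrableOn g (Ioi (0 : ℝ)))
    (hgd : IntegrableOn (fun u => g u / (u : ℂ)) (Ioi (0 : ℝ)))
    (hF : IntegrableOn (modifiedSum g) (Ioi (0 : ℝ)))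
    (hK : ContinuousOn (coSum g) (Ici 0)) :
    EqOn (cosTransform (modifiedSum g))
      (fun ξ => coSum g ξ - ∫ u in Ioi (0 : ℝ), g u / (u : ℂ)) (Ici 0) := by
  set κ := ∫ u in Ioi (0 : ℝ), g u / (u : ℂ)
  have hK' : ContinuousOn (fun ξ => coSum g ξ - κ) (Ici 0) := hK.sub continuousOn_const
  have hF' := continuous_cosTransform hF
  have hloc : LocallyIntegrableOn
      (fun ξ => cosTransform (modifiedSum g) ξ - (coSum g ξ - κ)) (Ioi (0 : ℝ)) :=
    ((hF'.continuousOn.sub hK').mono Ioi_subset_Ici_self).locallyIntegrableOn measurableSet_Ioi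
  have key := ae_eq_zero_of_forall_even_schwartz isOpen_Ioi Subset.rfl hloc
    fun Θ he _ _ => by
      obtain ⟨C, hC, hw⟩ := Θ.exists_norm_le_div_sq
      obtain ⟨c1, c2⟩ := integrable_coSumTerm_mul hgd Θ.continuous hC hw
      have hs := hasSum_integral_of_summable_integral_norm c1 c2
      have hi := integrable_tsum_of_summable_integral_norm c1 c2
      simp only [tsum_mul_right] at hs hi
      -- Pairing with `𝓕 Θ` puts `𝓕 (𝓕 Θ) = Θ` in the series, which is then the co-sum tested
      -- against `Θ`.
      have hW := hasSum_integral_modifiedSum_mul hg hgd (fourier_even he)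
      simp only [fourier_fourier_of_even he, ← integral_coSumTerm_mul] at hW
      have heq := hW.unique hs
      have hM := integral_mul_cosTransform_dilation hF (Θ.integrable.integrableOn (s := Ioi 0)) 1
      simp only [one_mul, ← fourier_eq_cosTransform he] at hM
      have hi' : IntegrableOn (fun ξ => coSum g ξ * Θ ξ) (Ioi (0 : ℝ)) := hi
      have hκ : IntegrableOn (fun ξ => κ * Θ ξ) (Ioi (0 : ℝ)) :=
        Θ.integrable.integrableOn.const_mul _
      have hsub : IntegrableOn (fun ξ => coSum g ξ * Θ ξ - κ * Θ ξ) (Ioi (0 : ℝ)) := hi'.sub hκ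
      have hs' : ∫ ξ in Ioi (0 : ℝ), coSum g ξ * Θ ξ =
          (∫ x in Ioi (0 : ℝ), modifiedSum g x * 𝓕 Θ x) + 𝓕 Θ 0 / 2 * κ := heq.symm
      simp only [sub_mul]
      rw [integral_sub (integrable_cosTransform_mul_schwartz hF Θ).integrableOn hsub,
        integral_sub hi' hκ, integral_const_mul, integral_Ioi_eq_fourier_zero_div_two he, hs', ← hM]
      ring
  refine Measure.eqOn_of_ae_eq (μ := volume) ?_ hF'.continuousOn hK' ?_
  · rw [Filter.EventuallyEq, ← restrict_Ioi_eq_restrict_Ici, ae_restrict_iff' measurableSet_Ioi]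
    filter_upwards [key] with x hx hx0
    exact sub_eq_zero.1 (hx hx0)
  · rw [interior_Ici, closure_Ioi]

/-- If `g(u)/u` is integrable and `g` is continuous at the origin then `g(0) = 0`. -/
lemma eq_zero_of_integrableOn_div (hgc : ContinuousWithinAt g (Ioi 0) 0)
    (hgd : IntegrableOn (fun u => g u / (u : ℂ)) (Ioi (0 : ℝ))) : g 0 = 0 := by
  by_contra h0
  have hpos : 0 < ‖g 0‖ := norm_pos_iff.2 h0
  have hev : ∀ᶠ x in 𝓝[>] (0 : ℝ), ‖g 0‖ / 2 < ‖g x‖ :=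
    hgc.norm.eventually (lt_mem_nhds (half_lt_self hpos))
  obtain ⟨δ, hδ, hsub⟩ := mem_nhdsGT_iff_exists_Ioo_subset.1 hev
  have hδ : 0 < δ := hδ
  -- If `g 0 ≠ 0`, then `1/x` is dominated by a multiple of `‖g x / x‖` near `0`, which is
  -- impossible.
  have hint : IntegrableOn (fun x : ℝ => x⁻¹) (Ioo 0 δ) := by
    refine Integrable.mono' ((hgd.mono_set Ioo_subset_Ioi_self).norm.const_mul (2 / ‖g 0‖))
      measurable_inv.aestronglyMeasurable ?_
    filter_upwards [ae_restrict_mem measurableSet_Ioo] with x hx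
    have hx0 : 0 < x := hx.1
    have hgx : ‖g 0‖ / 2 < ‖g x‖ := hsub hx
    rw [norm_div, Complex.norm_real, Real.norm_of_nonneg hx0.le,
      Real.norm_of_nonneg (inv_nonneg.2 hx0.le), inv_eq_one_div, ← mul_div_assoc]
    gcongr
    rw [div_mul_eq_mul_div, le_div_iff₀ hpos]
    linarith
  have h2 : IntervalIntegrable (fun x : ℝ => x⁻¹) volume 0 δ := by
    rwa [intervalIntegrable_iff_integrableOn_Ioo_of_le hδ.le]
  rw [intervalIntegrable_inv_iff] at h2
  rcases h2 with h2 | h2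
  · exact hδ.ne h2
  · exact h2 left_mem_uIcc

end CoSum

theorem mainTheorem4 (f : ℝ → ℂ)
    (hmeas : AEMeasurable f (volume.restrict (Ioi (0 : ℝ))))
    (hC : IntegrableOn (fun x : ℝ => (1 + 1 / x) * ‖f x‖) (Ioi (0 : ℝ)))
    (hlog : IntegrableAtFilter (fun y : ℝ => Real.log y * ‖cosTransform f y‖) atTop volume) :
    -- the cosine transform is integrable
    IntegrableOn (cosTransform f) (Ioi (0 : ℝ)) ∧
    -- `f` has a representative continuous on `[0, ∞)`
    (∃ g : ℝ → ℂ, ContinuousOn g (Ici 0) ∧ g =ᵐ[volume.restrict (Ioi (0 : ℝ))] f) ∧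
    -- what is claimed of the (unique) continuous representative
    ∀ g : ℝ → ℂ, ContinuousOn g (Ici 0) → g =ᵐ[volume.restrict (Ioi (0 : ℝ))] f →
      -- the series in `F` converges absolutely almost everywhere
      (∀ᵐ x ∂(volume.restrict (Ioi (0 : ℝ))), Summable (fun n : ℕ => sumTerm g n x)) ∧
      IntegrableOn (modifiedSum g) (Ioi (0 : ℝ)) ∧
      -- the co-sum converges uniformly on every `[0, X]`
      (∀ X : ℝ, TendstoUniformlyOn
        (fun (N : ℕ) (ξ : ℝ) => ∑ m ∈ Finset.range N, coSumTerm g m ξ)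
        (coSum g) atTop (Icc 0 X)) ∧
      -- pointwise co-Poisson formula
      ∀ ξ : ℝ, 0 ≤ ξ →
        cosTransform (modifiedSum g) ξ = coSum g ξ - ∫ u in Ioi (0 : ℝ), g u / (u : ℂ) := by
  have hf : IntegrableOn f (Ioi (0 : ℝ)) := by
    refine Integrable.mono' hC hmeas.aestronglyMeasurable ?_
    filter_upwards [ae_restrict_mem measurableSet_Ioi] with x hx
    have hx : 0 < x := hx
    exact le_mul_of_one_le_left (norm_nonneg _) (le_add_of_nonneg_right (by positivity))
  have hfd : IntegrableOn (fun u => f u / (u : ℂ)) (Ioi (0 : ℝ)) := by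
    refine Integrable.mono' hC
      (hmeas.div Complex.measurable_ofReal.aemeasurable).aestronglyMeasurable ?_
    filter_upwards [ae_restrict_mem measurableSet_Ioi] with x hx
    have hx : 0 < x := hx
    rw [norm_div, Complex.norm_real, Real.norm_of_nonneg hx.le, div_eq_mul_one_div, mul_comm]
    exact mul_le_mul_of_nonneg_right (le_add_of_nonneg_left zero_le_one) (norm_nonneg _)
  have hφ : LogIntegrable (cosTransform f) :=
    logIntegrable_of_integrableAtFilter (continuous_cosTransform hf) hlog
  have hinv := cosTransform_cosTransform_ae hf hφ.integrableOn
  have hcc := continuous_cosTransform hφ.integrableOn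
  refine ⟨hφ.integrableOn, ⟨_, hcc.continuousOn, hinv⟩, fun g hgc hgf => ?_⟩
  have hg : IntegrableOn g (Ioi (0 : ℝ)) := hf.congr hgf.symm
  have hgd : IntegrableOn (fun u => g u / (u : ℂ)) (Ioi (0 : ℝ)) := by
    refine hfd.congr ?_
    filter_upwards [hgf] with x hx
    rw [hx]
  rw [← cosTransform_congr_ae hgf] at hφ hinv hcc
  have heq : EqOn g (cosTransform (cosTransform g)) (Ici 0) := by
    refine Measure.eqOn_of_ae_eq (μ := volume) ?_ hgc hcc.continuousOn ?_
    · rw [← restrict_Ioi_eq_restrict_Ici]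
      exact hgf.trans hinv.symm
    · rw [interior_Ici, closure_Ioi]
  -- By inversion `g 0` is twice this integral.
  have h0 : ∫ y in Ioi (0 : ℝ), cosTransform g y = 0 := by
    have h := eq_zero_of_integrableOn_div
      ((hgc 0 self_mem_Ici).mono Ioi_subset_Ici_self) hgd
    rw [heq self_mem_Ici, cosTransform_zero] at h
    exact (mul_eq_zero.1 h).resolve_left two_ne_zero
  have hF := integrableOn_modifiedSum hg hgd hφ
  have hu := tendstoUniformlyOn_coSum heq hφ h0
  exact ⟨ae_summable_sumTerm hg, hF, hu, fun ξ hξ =>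
    cosTransform_modifiedSum_eq hg hgd hF (continuousOn_coSum hgc hu) hξ⟩
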